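/- Let $G$ be a countably infinite amenable group acting by homeomorphisms on a zero-dimensional compact metric space $X$ (a compact metric space with a base of clopen sets). Suppose that the action admits comparison and has a F\o lner system of disjoint quasitilings of $G$ as a topological factor. Then it has a tiling system, i.e. a congruent, deterministic F\o lner system of tilings of $G$, as a topological factor. Here the following terminology is used. For finite sets $K,F\subset G$ with $K,F\neq\emptyset$ and $\varepsilon>0$, $F$ is $(K,\varepsilon)$-invariant if $|KF\,\triangle\,F|<\varepsilon|F|$; a F\o lner sequence is a sequence of finite sets which are eventually $(K,\varepsilon)$-invariant for every such $K$ and $\varepsilon$; $G$ is amenable if it has a F\o lner sequence. The lower Banach density of $B\subset G$ is $\underline D(B)=\sup_F\inf_{g\in G}|B\cap Fg|/|F|$, with $F$ ranging over the nonempty finite subsets of $G$. A clopen set $A\subset X$ is subequivalent to a clopen set $B\subset X$ if there are a finite partition $A=\bigcup_{i=1}^kA_i$ into clopen sets and $g_1,\dots,g_k\in G$ such that $g_1(A_1),\dots,g_k(A_k)$ are disjoint subsets of $B$. The action admits comparison if, for all clopen $A,B\subset X$, the condition that $\mu(A)<\mu(B)$ for every $G$-invariant Borel probability measure $\mu$ on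 $X$ implies that $A$ is subequivalent to $B$. Let $\mathcal S$ be a finite collection of finite subsets of $G$ containing the unity $e$ (the shapes; the same set may occur several times in $\mathcal S$ under different labels), and let $\mathrm V=\mathcal S\cup\{0\}$. An element $x\in\mathrm V^G$ represents the quasitiling whose tiles are the sets $Sc$ with $S\in\mathcal S$, $c\in G$ and $x_c=S$; $c$ is the center of the tile $Sc$. The quasitiling is disjoint if the tiles with different centers are disjoint; it is a tiling if moreover the tiles cover $G$; it is an $\varepsilon$-quasitiling ($0<\varepsilon<1$) if the union of its tiles has lower Banach density at least $1-\varepsilon$ and each tile $T$ has a subset $T^\circ$ with $|T\setminus T^\circ|<\varepsilon|T|$ such that the sets $T^\circ$ are pairwise disjoint. A dynamical quasitiling with shapes $\mathcal S$ is a nonempty closed subset $\mathsf T\subset\mathrm V^G$ that is invariant under the shift action $(gx)_f=x_{fg}$; it is called disjoint, a dynamical $\varepsilon$-quasitiling, or a dynamical tiling if all its elements are disjoint, $\varepsilon$-quasitilings, or tilings, respectively. A F\o lner system of quasitilings is a topological joining $\mathbf T=\bigvee_{k\in\mathbb N}\mathsf T_k$ (a closed subset of $\prod_k\mathsf T_k$,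 invariant under the coordinatewise action and projecting onto every $\mathsf T_k$) of dynamical quasitilings $\mathsf T_k$ with shapes $\mathcal S_k$ such that, for some sequence $\varepsilon_k\in(0,1)$ decreasing to $0$, each $\mathsf T_k$ is a dynamical $\varepsilon_k$-quasitiling and, for every finite nonempty $K\subset G$ and $\varepsilon>0$, for all sufficiently large $k$ all shapes in $\mathcal S_k$ are $(K,\varepsilon)$-invariant. It is a F\o lner system of disjoint quasitilings (of tilings) if all $\mathsf T_k$ are disjoint (dynamical tilings). A F\o lner system of tilings is congruent if for every $(\mathcal T_k)_{k\in\mathbb N}\in\mathbf T$ and $k\in\mathbb N$ every tile of $\mathcal T_{k+1}$ is a union of tiles of $\mathcal T_k$; it is deterministic if for every $k\in\mathbb N$ and $S'\in\mathcal S_{k+1}$ there are sets $C_S(S')\subset S'$ $(S\in\mathcal S_k)$ such that $S'$ is the disjoint union of the sets $Sc$ with $S\in\mathcal S_k$, $c\in C_S(S')$, and for every $(\mathcal T_k)_{k\in\mathbb N}\in\mathbf T$, whenever $S'c'$ is a tile of $\mathcal T_{k+1}$ (with shape $S'$ and center $c'$), the sets $Scc'$ with $S\in\mathcal S_k$, $c\in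 C_S(S')$ are tiles of $\mathcal T_k$ (with shape $S$ and center $cc'$). A subsystem $Z$ of a $G$-system $Y$ is a topological factor of $X$ if there is a continuous $G$-equivariant map $X\to Y$ with image $Z$. -/

import Mathlib

open Set Filter Topology MeasureTheory
open scoped Pointwise symmDiff

namespace TilingSystems

noncomputable section

/-! ### Invariance and amenability -/

section Amenability

variable {G : Type*} [Group G]

open Classical in
/-- `F'` is an `ε`-modification of `F`: `|F ∆ F'| / |F| < ε`. (Written without division, so that
the empty set has no `ε`-modification.) -/
def IsModification (ε : ℝ) (F F' : Finset G) : Prop :=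
  ((F ∆ F').card : ℝ) < ε * (F.card : ℝ)

open Classical in
/-- `F` is `(K, ε)`-invariant: `K F` is an `ε`-modification of `F`. -/
def IsKInvariant (K : Finset G) (ε : ℝ) (F : Finset G) : Prop :=
  IsModification ε F (K * F)

/-- A Følner sequence: for every finite (nonempty) `K` and every `ε > 0`, the sets `F n` are
eventually `(K, ε)`-invariant. -/
def IsFolnerSequence (F : ℕ → Finset G) : Prop :=
  ∀ K : Finset G, K.Nonempty → ∀ ε : ℝ, 0 < ε → ∀ᶠ n in atTop, IsKInvariant K ε (F n)

variable (G) in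
/-- `G` is amenable: it possesses a Følner sequence. -/
def IsAmenable : Prop := ∃ F : ℕ → Finset G, IsFolnerSequence F

/-- The right translate `F g = {f g : f ∈ F}`. -/
def rightTranslate (F : Finset G) (g : G) : Finset G := F.map (mulRightEmbedding g)

/-- `inf_g |B ∩ F g| / |F|`. -/
def lowerDensityOn (F : Finset G) (B : Set G) : ℝ :=
  ⨅ g : G, ((B ∩ (rightTranslate F g : Set G)).ncard : ℝ) / (F.card : ℝ)

/-- The lower Banach density `sup_F inf_g |B ∩ F g| / |F|`, `F` ranging over the finite subsets
of `G`. (The empty set `F` contributes the value `0`, which does not change the supremum.) -/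
def lowerBanachDensity (B : Set G) : ℝ := ⨆ F : Finset G, lowerDensityOn F B

end Amenability

/-! ### Topological dynamics -/

/-- A subset of a dynamical system which is nonempty, closed and invariant. -/
structure IsSubsystem (G : Type*) [Group G] {Y : Type*} [TopologicalSpace Y] [MulAction G Y]
    (Z : Set Y) : Prop where
  nonempty : Z.Nonempty
  isClosed : IsClosed Z
  smul_mem : ∀ (g : G), ∀ y ∈ Z, g • y ∈ Z

/-- The subsystem `Z` of `Y` is a topological factor of the system `X`. -/
def IsFactorOf (G : Type*) [Group G] (X : Type*) [TopologicalSpace X] [MulAction G X]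
    {Y : Type*} [TopologicalSpace Y] [MulAction G Y] (Z : Set Y) : Prop :=
  ∃ π : X → Y, Continuous π ∧ (∀ (g : G) (x : X), π (g • x) = g • π x) ∧ range π = Z

/-- `A` is subequivalent to `B`: there is a finite partition of `A` into clopen sets `P i` and
there are elements `g i` such that the sets `g i (P i)` are disjoint subsets of `B`. -/
def IsSubequivalent (G : Type*) [Group G] {X : Type*} [TopologicalSpace X] [MulAction G X]
    (A B : Set X) : Prop :=
  ∃ (k : ℕ) (P : Fin k → Set X) (g : Fin k → G),
    (∀ i, IsClopen (P i)) ∧ Pairwise (fun i j => Disjoint (P i) (P j)) ∧ (⋃ i, P i) = A ∧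
    (∀ i, g i • P i ⊆ B) ∧ Pairwise (fun i j => Disjoint (g i • P i) (g j • P j))

/-- The action of `G` on `X` admits comparison. -/
def AdmitsComparison (G : Type*) [Group G] (X : Type*) [TopologicalSpace X] [MeasurableSpace X]
    [MulAction G X] : Prop :=
  ∀ A B : Set X, IsClopen A → IsClopen B →
    (∀ μ : Measure X, IsProbabilityMeasure μ → SMulInvariantMeasure G X μ → μ A < μ B) →
    IsSubequivalent G A B

/-! ### Symbolic configurations -/

/-- Configurations over the alphabet consisting of `n` shape labels and the symbol `none`
(meaning "no center here"). -/
def Config (G : Type*) (n : ℕ) : Type _ := G → Option (Fin n)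

/-- The product topology, the alphabet being discrete. -/
instance Config.topologicalSpace (G : Type*) (n : ℕ) : TopologicalSpace (Config G n) :=
  @Pi.topologicalSpace G (fun _ => Option (Fin n)) (fun _ => ⊥)

/-- The shift action `(g x)_f = x_{f g}`. -/
instance Config.mulAction (G : Type*) [Group G] (n : ℕ) : MulAction G (Config G n) where
  smul g x := fun f => x (f * g)
  one_smul x := funext fun f => congrArg x (mul_one f)
  mul_smul g h x := funext fun f => congrArg x (mul_assoc f g h).symm

/-! ### Quasitilings

A quasitiling with labelled shapes `shape i` (`i : Fin n`, each containing the unity; repeated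
shapes with different labels are allowed) is given by its symbolic representation
`x : Config G n`: the value `x c = some i` means that `c` is the center of the tile `(shape i) c`
and `x c = none` means that `c` is not a center. The tiles are thus indexed by their centers. -/

section Quasitilings

variable {G : Type*} [Group G] {n : ℕ}

/-- The set of centers. -/
def centers (x : Config G n) : Set G := {c | x c ≠ none}

/-- The tile with center `c` (the empty set if `c` is not a center). -/
def tile (shape : Fin n → Finset G) (x : Config G n) (c : G) : Finset G :=
  (x c).elim ∅ fun i => rightTranslate (shape i) c

/-- The union of all tiles. -/
def covered (shape : Fin n → Finset G) (x : Config G n) : Set G :=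
  ⋃ c ∈ centers x, (tile shape x c : Set G)

/-- The tiles are pairwise disjoint. -/
def IsDisjointQT (shape : Fin n → Finset G) (x : Config G n) : Prop :=
  (centers x).PairwiseDisjoint (tile shape x)

/-- `ε`-disjointness: every tile `T` has a `(1 - ε)`-subset `T°` such that the sets `T°` are
pairwise disjoint. -/
def IsEpsDisjointQT (ε : ℝ) (shape : Fin n → Finset G) (x : Config G n) : Prop :=
  ∃ core : G → Finset G,
    (∀ c ∈ centers x, core c ⊆ tile shape x c ∧ IsModification ε (tile shape x c) (core c)) ∧
    (centers x).PairwiseDisjoint core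

/-- `α`-covering: the union of the tiles has lower Banach density at least `α`. -/
def IsCoveringQT (α : ℝ) (shape : Fin n → Finset G) (x : Config G n) : Prop :=
  α ≤ lowerBanachDensity (covered shape x)

/-- A tiling: the tiles form a partition of `G`. -/
def IsTiling (shape : Fin n → Finset G) (x : Config G n) : Prop :=
  IsDisjointQT shape x ∧ covered shape x = univ

end Quasitilings

/-- A dynamical quasitiling: a subshift whose elements are interpreted as quasitilings with
shapes in a given finite (labelled) collection of finite sets containing the unity. -/
structure DynamicalQuasitiling (G : Type*) [Group G] where
  numShapes : ℕ
  shape : Fin numShapes → Finset G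
  one_mem_shape : ∀ i, (1 : G) ∈ shape i
  carrier : Set (Config G numShapes)
  isSubsystem : IsSubsystem G carrier

namespace DynamicalQuasitiling

variable {G : Type*} [Group G] (T : DynamicalQuasitiling G)

/-- `T` is disjoint. -/
def IsDisjoint : Prop := ∀ x ∈ T.carrier, IsDisjointQT T.shape x

/-- `T` is a dynamical `ε`-quasitiling. -/
def IsEpsQuasitiling (ε : ℝ) : Prop :=
  ∀ x ∈ T.carrier, IsEpsDisjointQT ε T.shape x ∧ IsCoveringQT (1 - ε) T.shape x

/-- `T` is a dynamical tiling. -/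
def IsDynamicalTiling : Prop := ∀ x ∈ T.carrier, IsTiling T.shape x

end DynamicalQuasitiling

/-- A topological joining of a sequence of dynamical quasitilings: a closed subset of the
product, invariant under the coordinatewise action, projecting onto every coordinate. -/
structure QuasitilingJoining (G : Type*) [Group G] where
  level : ℕ → DynamicalQuasitiling G
  carrier : Set (∀ k, Config G (level k).numShapes)
  isSubsystem : IsSubsystem G carrier
  image_eval : ∀ k, (fun x => x k) '' carrier = (level k).carrier

namespace QuasitilingJoining

variable {G : Type*} [Group G] (T : QuasitilingJoining G)

/-- A Følner system of quasitilings: the `k`th member is a dynamical `ε k`-quasitiling, where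
`ε k` decreases to `0`, and for all `K` and `δ > 0` all shapes of all members with sufficiently
large index are `(K, δ)`-invariant. -/
def IsFolnerSystem : Prop :=
  (∃ ε : ℕ → ℝ, Antitone ε ∧ Tendsto ε atTop (𝓝 0) ∧
    ∀ k, 0 < ε k ∧ ε k < 1 ∧ (T.level k).IsEpsQuasitiling (ε k)) ∧
  ∀ K : Finset G, K.Nonempty → ∀ δ : ℝ, 0 < δ →
    ∀ᶠ k in atTop, ∀ i, IsKInvariant K δ ((T.level k).shape i)

/-- A Følner system of disjoint quasitilings. -/
def IsFolnerSystemOfDisjointQuasitilings : Prop :=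
  T.IsFolnerSystem ∧ ∀ k, (T.level k).IsDisjoint

/-- A Følner system of tilings. -/
def IsFolnerSystemOfTilings : Prop :=
  T.IsFolnerSystem ∧ ∀ k, (T.level k).IsDynamicalTiling

/-- Congruency: every tile of the `(k+1)`st tiling is a union of tiles of the `k`th one. -/
def IsCongruent : Prop :=
  ∀ x ∈ T.carrier, ∀ k, ∀ c' ∈ centers (x (k + 1)), ∃ D ⊆ centers (x k),
    (tile (T.level (k + 1)).shape (x (k + 1)) c' : Set G) =
      ⋃ c ∈ D, (tile (T.level k).shape (x k) c : Set G)

/-- Determinism: every shape `S'` of the `(k+1)`st tiling is a disjoint union of sets `S c`,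
where `S` is a shape of the `k`th tiling and `c ∈ C_S(S') ⊆ S'`, such that whenever `S' c'` is a
tile of the `(k+1)`st tiling, the sets `S c c'` are tiles of the `k`th tiling joined with it. -/
def IsDeterministic : Prop :=
  ∀ k (j : Fin (T.level (k + 1)).numShapes), ∃ C : Fin (T.level k).numShapes → Finset G,
    (∀ i, C i ⊆ (T.level (k + 1)).shape j) ∧
    ((T.level (k + 1)).shape j : Set G) =
      (⋃ i, ⋃ c ∈ C i, (rightTranslate ((T.level k).shape i) c : Set G)) ∧
    ({p | p.2 ∈ C p.1} : Set (Fin (T.level k).numShapes × G)).PairwiseDisjoint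
      (fun p => rightTranslate ((T.level k).shape p.1) p.2) ∧
    ∀ x ∈ T.carrier, ∀ c', x (k + 1) c' = some j → ∀ i, ∀ c ∈ C i, x k (c * c') = some i

/-- A tiling system: a congruent, deterministic Følner system of tilings. -/
def IsTilingSystem : Prop :=
  T.IsFolnerSystemOfTilings ∧ T.IsCongruent ∧ T.IsDeterministic

end QuasitilingJoining

end

end TilingSystems

/-!
Throughout, `X` is the given compact space. A continuous equivariant assignment of a partition of
`G` into finite sets to every point of `X` is encoded by a single locally constant function
`N : X → G`: in the partition of `x`, the element `g` lies in the class named `N (g • x) * g`. This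
automatically gives partitions, equivariance and, by compactness, finiteness of the classes
(`cell`); classes can be named after one of their elements (`exists_recentering`), which then serves
as the center of a tile.

*Getting one tiling.* Take a disjoint quasitiling from the given system, with very invariant shapes
and covering `G` up to very small density. The lower Banach density of the covered part bounds from
below the measure of the clopen set of points at which `1` is covered, for every invariant
probability measure (`ofReal_le_measure_of_lt_lowerBanachDensity`); so the uncovered set has small
measure, while a selection of a small proportion of the elements of every tile has larger measure.
Comparison then gives an equivariant, locally determined injection of the uncovered elements into
the selected ones (`AdmitsComparison.isSubequivalent_shadow`). Let every uncovered element join the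
tile of its image: the tiles grow only a little, hence remain invariant, and now they cover `G`
(`exists_almostInvariant_cells`).

*Congruency.* Given the `k`th tiling, take a tiling as above whose tiles are much more invariant
than the `k`th tiles are large, and replace each of its tiles by the union of the `k`th tiles
centered in it. This is a small modification again (`exists_merging`), and iteration gives a
`TilingTower`.

*Determinism.* Label every tile by its shape together with the positions and the labels of the tiles
of the previous level inside it (`TilingTower.label`). Labels are locally constant, so that only
finitely many occur at each level, and the label of a tile determines the labels of its subtiles
(`TilingTower.label_subtile`). The image of `X` under the labelled tilings is the tiling system
`TilingTower.joining`.
-/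

namespace TilingSystems

noncomputable section

open Classical

/-! ### Almost invariant finite sets -/

section AlmostInvariant

variable {G : Type*} [Group G]

/-- One-sided invariance: `K F` exceeds `F` by at most `δ |F|` elements. -/
def AlmostInvariant (K : Finset G) (δ : ℝ) (F : Finset G) : Prop :=
  (((K * F) \ F).card : ℝ) ≤ δ * F.card

lemma IsKInvariant.almostInvariant {K F : Finset G} {δ : ℝ} (h : IsKInvariant K δ F) :
    AlmostInvariant K δ F := by
  unfold IsKInvariant IsModification at h
  refine le_trans ?_ h.le
  have : (K * F) \ F ⊆ F ∆ (K * F) := by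
    intro g hg
    simp only [Finset.mem_symmDiff]
    exact Or.inr (Finset.mem_sdiff.1 hg)
  exact_mod_cast Finset.card_le_card this

lemma AlmostInvariant.mono {K K' F : Finset G} {δ δ' : ℝ} (h : AlmostInvariant K' δ F)
    (hK : K ⊆ K') (hδ : δ ≤ δ') : AlmostInvariant K δ' F := by
  have h1 : (((K * F) \ F).card : ℝ) ≤ ((K' * F) \ F).card := by
    exact_mod_cast Finset.card_le_card
      (Finset.sdiff_subset_sdiff (Finset.mul_subset_mul_right hK) subset_rfl)
  have h2 : δ * (F.card : ℝ) ≤ δ' * F.card := by gcongr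
  exact (h1.trans h).trans h2

/-- As `|F| ≤ |K F|`, the part of `F` outside `K F` is no larger than the part of `K F`
outside `F`. -/
lemma AlmostInvariant.isKInvariant {K F : Finset G} {δ ε : ℝ} (h : AlmostInvariant K δ F)
    (hK : K.Nonempty) (hF : F.Nonempty) (hδ : 2 * δ < ε) : IsKInvariant K ε F := by
  unfold IsKInvariant IsModification
  have h1 : (F \ (K * F)).card ≤ ((K * F) \ F).card :=
    Finset.card_sdiff_le_card_sdiff_iff.2 (Finset.card_le_card_mul_left hK)
  have h2 : (F ∆ (K * F)).card ≤ (F \ (K * F)).card + ((K * F) \ F).card := by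
    have : F ∆ (K * F) = F \ (K * F) ∪ ((K * F) \ F) := by
      ext g; simp [Finset.mem_symmDiff]
    rw [this]; exact Finset.card_union_le _ _
  have h3 : ((F ∆ (K * F)).card : ℝ) ≤ 2 * ((K * F) \ F).card := by
    have : (F ∆ (K * F)).card ≤ 2 * ((K * F) \ F).card := by omega
    exact_mod_cast this
  have hpos : (0 : ℝ) < F.card := by exact_mod_cast hF.card_pos
  unfold AlmostInvariant at h
  convert lt_of_le_of_lt h3 (?_ : _ < ε * (F.card : ℝ)) using 2
  nlinarith

lemma mem_rightTranslate {F : Finset G} {u g : G} :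
    g ∈ rightTranslate F u ↔ g * u⁻¹ ∈ F := by
  simp only [rightTranslate, Finset.mem_map, mulRightEmbedding_apply]
  constructor
  · rintro ⟨a, ha, rfl⟩; simpa using ha
  · intro h; exact ⟨_, h, by simp⟩

lemma AlmostInvariant.rightTranslate {K F : Finset G} {δ : ℝ} (h : AlmostInvariant K δ F)
    (u : G) : AlmostInvariant K δ (rightTranslate F u) := by
  have h1 : (K * TilingSystems.rightTranslate F u) \ TilingSystems.rightTranslate F u
      = TilingSystems.rightTranslate ((K * F) \ F) u := by
    ext g
    simp only [Finset.mem_sdiff, mem_rightTranslate, Finset.mem_mul]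
    constructor
    · rintro ⟨⟨a, ha, b, hb, rfl⟩, h2⟩
      exact ⟨⟨a, ha, _, hb, by group⟩, h2⟩
    · rintro ⟨⟨a, ha, b, hb, h3⟩, h2⟩
      exact ⟨⟨a, ha, b * u, by simpa using hb, by rw [← mul_assoc, h3]; group⟩, h2⟩
  unfold AlmostInvariant at *
  rw [h1]
  simpa [TilingSystems.rightTranslate] using h

/-- Invariance survives a small modification of the set. -/
lemma AlmostInvariant.modify {K F F' : Finset G} {δ η : ℝ} (h : AlmostInvariant K δ F)
    (h1 : ((F \ F').card : ℝ) ≤ η * F.card) (h2 : ((F' \ F).card : ℝ) ≤ η * F.card)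
    (hη : η ≤ 1 / 2) (hη0 : 0 ≤ η) (hδ : 0 ≤ δ) :
    AlmostInvariant K (2 * (δ + (1 + K.card) * η)) F' := by
  have hs : (K * F') \ F' ⊆ ((K * F) \ F) ∪ (F \ F') ∪ K * (F' \ F) := by
    intro g hg
    obtain ⟨hg1, hg2⟩ := Finset.mem_sdiff.1 hg
    obtain ⟨a, ha, b, hb, rfl⟩ := Finset.mem_mul.1 hg1
    by_cases hbF : b ∈ F
    · by_cases hab : a * b ∈ F
      · exact Finset.mem_union_left _ (Finset.mem_union_right _ (Finset.mem_sdiff.2 ⟨hab, hg2⟩))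
      · exact Finset.mem_union_left _ (Finset.mem_union_left _
          (Finset.mem_sdiff.2 ⟨Finset.mul_mem_mul ha hbF, hab⟩))
    · exact Finset.mem_union_right _ (Finset.mul_mem_mul ha (Finset.mem_sdiff.2 ⟨hb, hbF⟩))
  have hc : (((K * F') \ F').card : ℝ)
      ≤ ((K * F) \ F).card + (F \ F').card + K.card * (F' \ F).card := by
    have e1 := Finset.card_le_card hs
    have e2 := Finset.card_union_le (((K * F) \ F) ∪ (F \ F')) (K * (F' \ F))
    have e3 := Finset.card_union_le ((K * F) \ F) (F \ F')
    have e4 := Finset.card_mul_le (s := K) (t := F' \ F)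
    exact_mod_cast (by omega : ((K * F') \ F').card
      ≤ ((K * F) \ F).card + (F \ F').card + K.card * (F' \ F).card)
  have hF : (F.card : ℝ) ≤ 2 * F'.card := by
    have e1 : F.card ≤ (F \ F').card + F'.card := by
      have := Finset.card_le_card_sdiff_add_card (s := F) (t := F')
      omega
    have e2 : (F.card : ℝ) ≤ (F \ F').card + F'.card := by exact_mod_cast e1
    have e3 : η * (F.card : ℝ) ≤ 1 / 2 * F.card := by gcongr
    linarith
  unfold AlmostInvariant at *
  have hK0 : (0 : ℝ) ≤ K.card := by positivity
  calc (((K * F') \ F').card : ℝ) ≤ δ * F.card + η * F.card + K.card * (η * F.card) := by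
        refine hc.trans ?_
        gcongr
    _ = (δ + (1 + K.card) * η) * F.card := by ring
    _ ≤ (δ + (1 + K.card) * η) * (2 * F'.card) := by gcongr
    _ = _ := by ring

/-- A set which is almost invariant under a large set `K` is itself large. -/
lemma AlmostInvariant.card_le {K F : Finset G} (h : AlmostInvariant K 1 F)
    (hF : F.Nonempty) : K.card ≤ 2 * F.card := by
  have h1 : K.card ≤ (K * F).card := Finset.card_le_card_mul_right hF
  have h2 : (K * F).card ≤ ((K * F) \ F).card + F.card := by
    have := Finset.card_le_card_sdiff_add_card (s := K * F) (t := F)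
    omega
  have h3 : ((K * F) \ F).card ≤ F.card := by
    unfold AlmostInvariant at h
    rw [one_mul] at h
    exact_mod_cast h
  omega

end AlmostInvariant

/-! ### Locally constant names and their cells -/

section Cells

variable {G : Type*} [Group G] {X : Type*} [TopologicalSpace X] [MulAction G X]

/-- A function `N : X → G` gives every `g ∈ G`, in the configuration of a point `x`, the name
`N (g • x) * g`; this naming is equivariant. The cell of `x` is the set of the elements named
`1`, so that the elements named `c` form the set `(cell N (c • x)) c`. (The set is finite if `N`
is locally constant and `X` is compact; an infinite set is replaced by `∅`.) -/
def cell (N : X → G) (x : X) : Finset G :=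
  if h : {g : G | N (g • x) * g = 1}.Finite then h.toFinset else ∅

variable {N : X → G}

lemma eventually_smul_eq [ContinuousConstSMul G X] {α : Type*} {f : X → α}
    (hf : IsLocallyConstant f) (g : G) (x : X) :
    ∀ᶠ y in 𝓝 x, f (g • y) = f (g • x) :=
  ((continuous_const_smul g).tendsto x).eventually (hf.eventually_eq (g • x))

lemma isLocallyConstant_smul_comp [ContinuousConstSMul G X] {α : Type*} {f : X → α}
    (hf : IsLocallyConstant f)
    (hN : IsLocallyConstant N) : IsLocallyConstant fun x => f (N x • x) := by
  rw [IsLocallyConstant.iff_eventually_eq]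
  intro x
  filter_upwards [hN.eventually_eq x, eventually_smul_eq hf (N x) x] with y h1 h2
  rw [h1, h2]

variable [CompactSpace X]

lemma finite_setOf_mul_eq_one (hN : IsLocallyConstant N) (x : X) :
    {g : G | N (g • x) * g = 1}.Finite := by
  refine (hN.range_finite.inv).subset ?_
  intro g hg
  rw [Set.mem_inv]
  exact ⟨g • x, eq_inv_of_mul_eq_one_left hg⟩

lemma mem_cell (hN : IsLocallyConstant N) {x : X} {g : G} :
    g ∈ cell N x ↔ N (g • x) * g = 1 := by
  simp [cell, finite_setOf_mul_eq_one hN x]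

variable [ContinuousConstSMul G X]

lemma eventually_cell_eq (hN : IsLocallyConstant N) (x : X) :
    ∀ᶠ y in 𝓝 x, cell N y = cell N x := by
  have h : ∀ᶠ y in 𝓝 x, ∀ g ∈ (range N)⁻¹, N (g • y) = N (g • x) :=
    (hN.range_finite.inv.eventually_all).2 fun g _ => eventually_smul_eq hN g x
  filter_upwards [h] with y hy
  ext g
  rw [mem_cell hN, mem_cell hN]
  constructor
  · intro hg
    rwa [← hy g ⟨g • y, eq_inv_of_mul_eq_one_left hg⟩]
  · intro hg
    rwa [hy g ⟨g • x, eq_inv_of_mul_eq_one_left hg⟩]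

/-- Every locally constant naming can be replaced by one in which each class is named after one
of its own elements, without changing the partition into classes. -/
lemma exists_recentering (hN : IsLocallyConstant N) :
    ∃ r : X → G, IsLocallyConstant r ∧ (∀ x, r (r x • x) = 1) ∧
      (∀ x g h, N (g • x) * g = N (h • x) * h → r (g • x) * g = r (h • x) * h) ∧
      ∀ x, (cell r x).Nonempty → ∃ u : G, (cell N (u • x)).Nonempty ∧
        cell r x = rightTranslate (cell N (u • x)) u := by
  let φ : Finset G → G := fun F => if h : F.Nonempty then h.choose else 1
  have hφ : ∀ F : Finset G, F.Nonempty → φ F ∈ F := fun F h => by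
    simp only [φ, dif_pos h]; exact h.choose_spec
  let r : X → G := fun x => φ (cell N (N x • x)) * N x
  have hmem : ∀ x, (N x)⁻¹ ∈ cell N (N x • x) := fun x => by
    rw [mem_cell hN]; simp
  have hr : IsLocallyConstant r := by
    rw [IsLocallyConstant.iff_eventually_eq]
    intro x
    filter_upwards [hN.eventually_eq x, ((continuous_const_smul (N x)).tendsto x).eventually
      (eventually_cell_eq hN (N x • x))] with y h1 h2
    simp only [r]
    rw [h1, h2]
  have hNr : ∀ x, N (r x • x) * r x = N x := by
    intro x
    have h1 := (mem_cell hN).1 (hφ _ ⟨_, hmem x⟩)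
    have h2 : r x • x = φ (cell N (N x • x)) • N x • x := by simp only [r]; rw [mul_smul]
    rw [h2]
    simp only [r]
    rw [← mul_assoc, h1, one_mul]
  have hroot : ∀ x g, r (g • x) * g
      = φ (cell N ((N (g • x) * g) • x)) * (N (g • x) * g) := by
    intro x g
    simp only [r]
    rw [mul_smul, mul_assoc]
  refine ⟨r, hr, ?_, ?_, ?_⟩
  · intro x
    have h1 := hroot x (r x)
    rw [hNr x] at h1
    exact mul_eq_right.1 h1
  · intro x g h hgh
    rw [hroot, hroot, hgh]
  · rintro x ⟨g, hg⟩
    rw [mem_cell hr] at hg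
    -- all elements of the new cell have the same old name
    have key : ∀ a, r (a • x) * a = 1 → N (a • x) * a = N x := by
      intro a ha
      have h1 := hNr (a • x)
      rw [← mul_smul, ha, one_smul] at h1
      rw [← h1, mul_assoc, ha, mul_one]
    refine ⟨N x, ⟨_, hmem x⟩, ?_⟩
    have hrx : r x = 1 := by
      have h1 := hroot x 1
      rw [one_smul, mul_one, mul_one, ← key g hg, ← hroot, hg] at h1
      exact h1
    ext a
    rw [mem_cell hr, mem_rightTranslate, mem_cell hN, ← mul_smul, inv_mul_cancel_right,
      ← mul_assoc, mul_inv_eq_one]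
    refine ⟨key a, fun ha => ?_⟩
    have h1 := hroot x 1
    rw [one_smul, mul_one, mul_one] at h1
    rw [hroot, ha, ← h1, hrx]

/-- The classes of a naming supplied by `hinv` are changed into unions of classes of `r`, by letting
every class of `r` follow the element after which it is named. If the cells supplied are much more
invariant than the range of `r` is large, the new cells are still invariant. -/
lemma exists_merging {r : X → G} (hr : IsLocallyConstant r) (K : Finset G) {δ : ℝ} (hδ : 0 < δ)
    (hinv : ∀ (K : Finset G) (δ : ℝ), 0 < δ → ∃ N : X → G, IsLocallyConstant N ∧
      ∀ x, (cell N x).Nonempty → AlmostInvariant K δ (cell N x)) :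
    ∃ N : X → G, IsLocallyConstant N ∧
      (∀ x, (cell N x).Nonempty → AlmostInvariant K δ (cell N x)) ∧
      ∀ x g h, r (g • x) * g = r (h • x) * h → N (g • x) * g = N (h • x) * h := by
  let R : Finset G := hr.range_finite.toFinset
  have hR : ∀ x, r x ∈ R := fun x => by simp [R]
  -- `η` bounds the relative size of the change of a cell
  let η : ℝ := min (1 / 2) (δ / (4 * (1 + K.card)))
  have hη : 0 < η := by positivity
  have hη1 : η ≤ 1 / 2 := min_le_left _ _
  have hη2 : (1 + K.card) * η ≤ δ / 4 := by
    have : η ≤ δ / (4 * (1 + K.card)) := min_le_right _ _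
    calc (1 + K.card) * η ≤ (1 + K.card) * (δ / (4 * (1 + K.card))) := by gcongr
      _ = δ / 4 := by field_simp
  let δ' : ℝ := min (δ / 4) (η / (1 + R.card))
  have hδ' : 0 < δ' := by positivity
  have hδ1 : δ' ≤ δ / 4 := min_le_left _ _
  have hδ2 : (1 + R.card) * δ' ≤ η := by
    have : δ' ≤ η / (1 + R.card) := min_le_right _ _
    calc (1 + R.card) * δ' ≤ (1 + R.card) * (η / (1 + R.card)) := by gcongr
      _ = η := by field_simp
  obtain ⟨M, hM, hMinv⟩ := hinv (K ∪ (R ∪ R⁻¹)) δ' hδ'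
  let N : X → G := fun x => M (r x • x) * r x
  have hN : IsLocallyConstant N := (isLocallyConstant_smul_comp hM hr).mul hr
  have hroot : ∀ x g, N (g • x) * g = M ((r (g • x) * g) • x) * (r (g • x) * g) := by
    intro x g
    simp only [N]
    rw [mul_smul, mul_assoc]
  have hcell : ∀ x g, g ∈ cell N x ↔ r (g • x) * g ∈ cell M x := by
    intro x g
    rw [mem_cell hN, mem_cell hM, hroot]
  refine ⟨N, hN, ?_, ?_⟩
  · rintro x ⟨g, hg⟩
    have hinvx := hMinv x ⟨_, (hcell x g).1 hg⟩
    set S := cell M x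
    have hc1 : (((R * S) \ S).card : ℝ) ≤ δ' * S.card :=
      hinvx.mono (Finset.subset_union_left.trans Finset.subset_union_right) le_rfl
    have hc2 : (((R⁻¹ * S) \ S).card : ℝ) ≤ δ' * S.card :=
      hinvx.mono (Finset.subset_union_right.trans Finset.subset_union_right) le_rfl
    have hS0 : (0 : ℝ) ≤ S.card := by positivity
    have hR0 : (0 : ℝ) ≤ R.card := by positivity
    have hadd : cell N x \ S ⊆ (R⁻¹ * S) \ S := by
      intro a ha
      obtain ⟨ha1, ha2⟩ := Finset.mem_sdiff.1 ha
      refine Finset.mem_sdiff.2 ⟨?_, ha2⟩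
      have := Finset.mul_mem_mul (Finset.inv_mem_inv (hR (a • x))) ((hcell x a).1 ha1)
      rwa [inv_mul_cancel_left] at this
    have hdel : S \ cell N x ⊆ R⁻¹ * ((R * S) \ S) := by
      intro a ha
      obtain ⟨ha1, ha2⟩ := Finset.mem_sdiff.1 ha
      rw [hcell] at ha2
      have := Finset.mul_mem_mul (Finset.inv_mem_inv (hR (a • x)))
        (Finset.mem_sdiff.2 ⟨Finset.mul_mem_mul (hR (a • x)) ha1, ha2⟩)
      rwa [inv_mul_cancel_left] at this
    have hadd' : ((cell N x \ S).card : ℝ) ≤ η * S.card := by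
      have : ((cell N x \ S).card : ℝ) ≤ ((R⁻¹ * S) \ S).card := by
        exact_mod_cast Finset.card_le_card hadd
      have h3 : δ' * (S.card : ℝ) ≤ η * S.card := by
        gcongr
        nlinarith
      linarith
    have hdel' : ((S \ cell N x).card : ℝ) ≤ η * S.card := by
      have h1 : ((S \ cell N x).card : ℝ) ≤ R.card * ((R * S) \ S).card := by
        have := (Finset.card_le_card hdel).trans Finset.card_mul_le
        rw [Finset.card_inv] at this
        exact_mod_cast this
      have h2 : (R.card : ℝ) * ((R * S) \ S).card ≤ R.card * (δ' * S.card) := by gcongr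
      have h3 : ((1 + R.card) * δ') * S.card ≤ η * S.card := by gcongr
      nlinarith [mul_nonneg hδ'.le hS0]
    refine ((hinvx.mono Finset.subset_union_left le_rfl).modify hdel' hadd' hη1 hη.le
      hδ'.le).mono subset_rfl ?_
    linarith
  · intro x g h hgh
    rw [hroot, hroot, hgh]

end Cells

/-! ### Density of visits and invariant measures -/

section Density

open scoped ENNReal

variable {G : Type*} [Group G]

lemma exists_le_card_filter_of_lt_lowerBanachDensity {B : Set G} {α : ℝ} (hα : 0 < α)
    (h : α < lowerBanachDensity B) :
    ∃ F : Finset G, F.Nonempty ∧ ∀ g : G, α * F.card ≤ (F.filter fun f => f * g ∈ B).card := by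
  obtain ⟨F, hF⟩ := exists_lt_of_lt_ciSup h
  have hle : ∀ g : G, α < ((B ∩ (rightTranslate F g : Set G)).ncard : ℝ) / (F.card : ℝ) :=
    fun g => hF.trans_le (ciInf_le ⟨0, by rintro _ ⟨g, rfl⟩; positivity⟩ g)
  have hne : F.Nonempty := by
    rw [Finset.nonempty_iff_ne_empty]
    rintro rfl
    have := hle 1
    simp at this
    linarith
  have hpos : (0 : ℝ) < F.card := by exact_mod_cast hne.card_pos
  refine ⟨F, hne, fun g => ?_⟩
  have h1 := (lt_div_iff₀ hpos).1 (hle g)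
  have h2 : B ∩ (rightTranslate F g : Set G)
      = (rightTranslate (F.filter fun f => f * g ∈ B) g : Set G) := by
    ext a
    simp only [mem_inter_iff, Finset.mem_coe, mem_rightTranslate, Finset.mem_filter,
      inv_mul_cancel_right]
    exact and_comm
  rw [h2, ncard_coe_finset] at h1
  simpa [rightTranslate] using h1.le

variable {X : Type*} [MulAction G X] [MeasurableSpace X] [MeasurableConstSMul G X]

/-- Double counting on an invariant set `D` all of whose points visit `C` with frequency at least
`a` along `F`. -/
lemma mul_measure_le_measure_inter {C D : Set X} (hC : MeasurableSet C) (hD : MeasurableSet D)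
    (hinv : ∀ (g : G) x, g • x ∈ D ↔ x ∈ D) (μ : Measure X) [SMulInvariantMeasure G X μ]
    {F : Finset G} (hF : F.Nonempty) {a : ℝ≥0∞}
    (h : ∀ x ∈ D, a * F.card ≤ ∑ f ∈ F, C.indicator (fun _ => 1) (f • x)) :
    a * μ D ≤ μ (C ∩ D) := by
  have h1 : ∀ f : G, ∫⁻ x in D, C.indicator (fun _ => 1) (f • x) ∂μ = μ (C ∩ D) := by
    intro f
    have e1 : (fun x : X => C.indicator (fun _ => (1 : ℝ≥0∞)) (f • x))
        = ((f • ·) ⁻¹' C).indicator (fun _ => 1) := by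
      ext x; simp [indicator]
    have hm : MeasurableSet ((f • · : X → X) ⁻¹' C) := measurable_const_smul f hC
    rw [e1, lintegral_indicator hm, setLIntegral_one, Measure.restrict_apply hm,
      ← measure_preimage_smul μ f (C ∩ D)]
    congr 1
    ext x
    simp [hinv]
  have h2 : a * F.card * μ D ≤ F.card * μ (C ∩ D) := by
    calc a * F.card * μ D = ∫⁻ _ in D, a * F.card ∂μ := by rw [setLIntegral_const]
      _ ≤ ∫⁻ x in D, ∑ f ∈ F, C.indicator (fun _ => 1) (f • x) ∂μ :=
        setLIntegral_mono' hD h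
      _ = ∑ f ∈ F, ∫⁻ x in D, C.indicator (fun _ => 1) (f • x) ∂μ := by
        refine lintegral_finsetSum _ fun f _ => ?_
        exact (measurable_const.indicator hC).comp (measurable_const_smul f)
      _ = F.card * μ (C ∩ D) := by simp [h1]
  have h0 : (F.card : ℝ≥0∞) ≠ 0 := by exact_mod_cast hF.card_pos.ne'
  rw [mul_comm a, mul_assoc] at h2
  exact (ENNReal.mul_le_mul_iff_right h0 (by simp)).1 h2

/-- The finite set that witnesses the lower Banach density may depend on the point, but there are
only countably many finite sets, so that the space splits into countably many invariant sets on
each of which one finite set serves all points. -/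
lemma ofReal_le_measure_of_lt_lowerBanachDensity [Countable G] {C : Set X}
    (hC : MeasurableSet C) (μ : Measure X) [IsProbabilityMeasure μ] [SMulInvariantMeasure G X μ]
    {α : ℝ} (hα : 0 < α) (h : ∀ x : X, α < lowerBanachDensity {g : G | g • x ∈ C}) :
    ENNReal.ofReal α ≤ μ C := by
  set a := ENNReal.ofReal α
  let s : Finset G → X → ℝ≥0∞ := fun F x => ∑ f ∈ F, C.indicator (fun _ => 1) (f • x)
  have hs : ∀ F, Measurable (s F) := fun F => Finset.measurable_sum _ fun f _ =>
    (measurable_const.indicator hC).comp (measurable_const_smul f)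
  let E : Finset G → Set X := fun F => {x | F.Nonempty ∧ ∀ g : G, a * F.card ≤ s F (g • x)}
  have hE : ∀ F, MeasurableSet (E F) := by
    intro F
    refine (MeasurableSet.const _).inter ?_
    change MeasurableSet {x | ∀ g : G, a * F.card ≤ s F (g • x)}
    rw [ofPred_forall]
    exact MeasurableSet.iInter fun g =>
      measurableSet_le measurable_const ((hs F).comp (measurable_const_smul g))
  have hEinv : ∀ F (g : G) x, g • x ∈ E F ↔ x ∈ E F := by
    intro F g x
    refine and_congr_right fun _ => ⟨fun h' k => ?_, fun h' k => ?_⟩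
    · simpa [smul_smul] using h' (k * g⁻¹)
    · simpa [smul_smul] using h' (k * g)
  have hEcov : ∀ x, ∃ F, x ∈ E F := by
    intro x
    obtain ⟨F, hF, hle⟩ := exists_le_card_filter_of_lt_lowerBanachDensity hα (h x)
    refine ⟨F, hF, fun g => ?_⟩
    have h1 : s F (g • x) = (F.filter fun f => f * g ∈ {g : G | g • x ∈ C}).card := by
      simp [s, indicator, mul_smul, Finset.sum_boole]
    rw [h1]
    have h2 := ENNReal.ofReal_le_ofReal (hle g)
    rwa [ENNReal.ofReal_mul hα.le, ENNReal.ofReal_natCast, ENNReal.ofReal_natCast] at h2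
  obtain ⟨e, he⟩ := exists_surjective_nat (Finset G)
  have hcov' : ∀ x, ∃ n, x ∈ E (e n) := fun x => by
    obtain ⟨F, hF⟩ := hEcov x
    obtain ⟨n, rfl⟩ := he F
    exact ⟨n, hF⟩
  let D : ℕ → Set X := fun n => {x | x ∈ E (e n) ∧ ∀ m < n, x ∉ E (e m)}
  have hD : ∀ n, MeasurableSet (D n) := by
    intro n
    refine (hE _).inter ?_
    change MeasurableSet {x | ∀ m < n, x ∉ E (e m)}
    simp only [ofPred_forall]
    exact MeasurableSet.iInter fun m => MeasurableSet.iInter fun _ => (hE _).compl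
  have hDinv : ∀ n (g : G) x, g • x ∈ D n ↔ x ∈ D n := by
    intro n g x
    simp only [D, mem_ofPred_eq, hEinv]
  have hDdisj : Pairwise (Function.onFun Disjoint D) := by
    intro m n hmn
    rw [Function.onFun, Set.disjoint_left]
    rintro x ⟨h1, h2⟩ ⟨h3, h4⟩
    rcases lt_or_gt_of_ne hmn with h5 | h5
    · exact h4 m h5 h1
    · exact h2 n h5 h3
  have hDcov : ⋃ n, D n = univ := by
    refine eq_univ_of_forall fun x => mem_iUnion.2 ⟨Nat.find (hcov' x), Nat.find_spec (hcov' x),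
      fun m hm => Nat.find_min (hcov' x) hm⟩
  have hle : ∀ n, a * μ (D n) ≤ μ (C ∩ D n) := by
    intro n
    by_cases hn : (D n).Nonempty
    · obtain ⟨x, hx⟩ := hn
      refine mul_measure_le_measure_inter hC (hD n) (hDinv n) μ hx.1.1 fun y hy => ?_
      simpa using hy.1.2 1
    · rw [not_nonempty_iff_eq_empty.1 hn]; simp
  calc a = a * μ (⋃ n, D n) := by rw [hDcov, measure_univ, mul_one]
    _ = ∑' n, a * μ (D n) := by rw [measure_iUnion hDdisj hD, ENNReal.tsum_mul_left]
    _ ≤ ∑' n, μ (C ∩ D n) := ENNReal.tsum_le_tsum hle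
    _ = μ (⋃ n, C ∩ D n) := (measure_iUnion (fun m n hmn =>
        (hDdisj hmn).mono inter_subset_right inter_subset_right) fun n => hC.inter (hD n)).symm
    _ = μ C := by rw [← inter_iUnion, hDcov, inter_univ]

end Density

/-! ### Completing a disjoint quasitiling by means of comparison -/

section Symbolic

variable {G : Type*} {n : ℕ} {X : Type*} [TopologicalSpace X]

lemma Config.isLocallyConstant_apply {f : X → Config G n} (hf : Continuous f) (g : G) :
    IsLocallyConstant fun x => f x g := by
  let _ : TopologicalSpace (Option (Fin n)) := ⊥
  have _ : DiscreteTopology (Option (Fin n)) := ⟨rfl⟩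
  have h : Continuous fun x => f x g := (continuous_apply g).comp hf
  exact fun s => (isOpen_discrete s).preimage h

lemma Config.continuous_of_isLocallyConstant {f : X → Config G n}
    (hf : ∀ g, IsLocallyConstant fun x => f x g) : Continuous f := by
  let _ : TopologicalSpace (Option (Fin n)) := ⊥
  have _ : DiscreteTopology (Option (Fin n)) := ⟨rfl⟩
  exact continuous_pi fun g => (hf g).continuous

instance Config.t2Space : T2Space (Config G n) := by
  let _ : TopologicalSpace (Option (Fin n)) := ⊥
  have _ : DiscreteTopology (Option (Fin n)) := ⟨rfl⟩
  exact inferInstanceAs (T2Space (G → Option (Fin n)))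

/-- Finitely many disjoint clopen sets, given together with values, define a locally constant
function. -/
lemma exists_isLocallyConstant_of_isClopen {ι α : Type*} [Finite ι] {P : ι → Set X}
    (hP : ∀ i, IsClopen (P i)) (hdisj : Pairwise fun i j => Disjoint (P i) (P j)) (v : ι → α)
    (d : α) :
    ∃ f : X → α, IsLocallyConstant f ∧ (∀ i, ∀ x ∈ P i, f x = v i) ∧
      ∀ x, (∀ i, x ∉ P i) → f x = d := by
  refine ⟨fun x => if h : ∃ i, x ∈ P i then v h.choose else d, ?_, ?_, ?_⟩
  · rw [IsLocallyConstant.iff_eventually_eq]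
    intro x
    have h1 : ∀ᶠ y in 𝓝 x, ∀ i, (y ∈ P i ↔ x ∈ P i) := by
      refine eventually_all.2 fun i => ?_
      by_cases hx : x ∈ P i
      · filter_upwards [(hP i).isOpen.mem_nhds hx] with y hy using by simp [hx, hy]
      · filter_upwards [(hP i).compl.isOpen.mem_nhds hx] with y hy
        simp only [hx, iff_false]
        exact hy
    filter_upwards [h1] with y hy
    simp only [hy]
  · intro i x hx
    have h : ∃ i, x ∈ P i := ⟨i, hx⟩
    have : h.choose = i := by
      by_contra hne
      exact Set.disjoint_left.1 (hdisj hne) h.choose_spec hx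
    simp only [dif_pos h, this]
  · intro x hx
    exact dif_neg (not_exists.2 hx)

end Symbolic

section Completion

variable {G : Type*} [Group G] {n : ℕ} {X : Type*} [MulAction G X]

/-- Let `p x` be the symbol at `1` of the quasitiling attached to `x`. The set `shadow B p` consists
of the points `x` for which `1` lies in the part `(B i) c` of some tile `(shape i) c`. -/
def shadow (B : Fin n → Finset G) (p : X → Option (Fin n)) : Set X :=
  {x | ∃ i, ∃ s ∈ B i, p (s⁻¹ • x) = some i}

/-- Disjointness of the quasitilings attached to the points of `X`: no point lies in two tiles. -/
def HasDisjointTiles (shape : Fin n → Finset G) (p : X → Option (Fin n)) : Prop :=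
  ∀ x, ∀ i, ∀ s ∈ shape i, ∀ j, ∀ t ∈ shape j,
    p (s⁻¹ • x) = some i → p (t⁻¹ • x) = some j → s = t

lemma isClopen_shadow [TopologicalSpace X] [ContinuousConstSMul G X] {p : X → Option (Fin n)}
    (hp : IsLocallyConstant p) (B : Fin n → Finset G) : IsClopen (shadow B p) := by
  have h : shadow B p = ⋃ i, ⋃ s ∈ B i, (s⁻¹ • · : X → X) ⁻¹' (p ⁻¹' {some i}) := by
    ext x; simp [shadow]
  rw [h]
  exact isClopen_iUnion_of_finite fun i => (B i).finite_toSet.isClopen_biUnion fun s _ =>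
    (hp.isClopen_fiber (some i)).preimage (continuous_const_smul _)

lemma measure_shadow [TopologicalSpace X] [ContinuousConstSMul G X] [MeasurableSpace X]
    [BorelSpace X] (μ : Measure X) [SMulInvariantMeasure G X μ] {p : X → Option (Fin n)}
    (hp : IsLocallyConstant p) {shape : Fin n → Finset G} (hdisj : HasDisjointTiles shape p)
    {B : Fin n → Finset G} (hB : ∀ i, B i ⊆ shape i) :
    μ (shadow B p) = ∑ i, (B i).card * μ (p ⁻¹' {some i}) := by
  have h : shadow B p = ⋃ q ∈ (Finset.univ.sigma B : Finset (Σ _ : Fin n, G)),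
      (q.2⁻¹ • · : X → X) ⁻¹' (p ⁻¹' {some q.1}) := by
    ext x; simp [shadow]
  rw [h, measure_biUnion_finset, Finset.sum_sigma]
  · simp [measure_preimage_smul]
  · rintro ⟨i, s⟩ hs ⟨j, t⟩ ht hne
    rw [Function.onFun, Set.disjoint_left]
    intro x h1 h2
    simp only [Finset.coe_sigma, mem_sigma_iff, Finset.mem_coe] at hs ht
    simp only [mem_preimage, mem_singleton_iff] at h1 h2
    obtain rfl := hdisj x i s (hB i hs.2) j t (hB j ht.2) h1 h2
    rw [h1] at h2
    obtain rfl := Option.some_injective _ h2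
    exact hne rfl
  · intro q _
    exact ((hp.isClopen_fiber _).preimage (continuous_const_smul _)).isOpen.measurableSet

/-- The uncovered elements are distributed injectively among the parts `(B i) c` of the tiles, and
each of them joins the tile to which it has been assigned. -/
lemma exists_name_of_isSubequivalent [TopologicalSpace X] [CompactSpace X]
    [ContinuousConstSMul G X] {p : X → Option (Fin n)} (hp : IsLocallyConstant p)
    {shape : Fin n → Finset G} (hdisj : HasDisjointTiles shape p) {B : Fin n → Finset G}
    (hB : ∀ i, B i ⊆ shape i) (hsub : IsSubequivalent G (shadow shape p)ᶜ (shadow B p)) :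
    ∃ N : X → G, IsLocallyConstant N ∧ ∀ x, (cell N x).Nonempty →
      ∃ i, shape i ⊆ cell N x ∧ (cell N x \ shape i).card ≤ (B i).card := by
  -- `M x` is the center of the tile covering `1`
  obtain ⟨M, hM, hMv, -⟩ := exists_isLocallyConstant_of_isClopen
    (ι := Σ i, ↥(shape i)) (P := fun q => (q.2.1⁻¹ • · : X → X) ⁻¹' (p ⁻¹' {some q.1}))
    (fun q => (hp.isClopen_fiber _).preimage (continuous_const_smul _)) (by
      rintro ⟨i, s, hs⟩ ⟨j, t, ht⟩ hne
      rw [Set.disjoint_left]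
      intro x h1 h2
      simp only [mem_preimage, mem_singleton_iff] at h1 h2
      obtain rfl := hdisj x i s hs j t ht h1 h2
      rw [h1] at h2
      obtain rfl := Option.some_injective _ h2
      exact hne rfl) (fun q => q.2.1⁻¹) (1 : G)
  have hMs : ∀ x i s, s ∈ shape i → p (s⁻¹ • x) = some i → M x = s⁻¹ := fun x i s hs hx =>
    hMv ⟨i, s, hs⟩ x hx
  obtain ⟨k, P, γ₀, hP, hPd, hPA, hPB, hPB'⟩ := hsub
  -- `γ x` moves an uncovered `1` to the element to which it has been assigned
  obtain ⟨γ, hγ, hγv, hγ1⟩ := exists_isLocallyConstant_of_isClopen hP hPd γ₀ 1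
  have hγcov : ∀ x ∈ shadow shape p, γ x = 1 := fun x hx => hγ1 x fun i hi => by
    have : x ∈ (shadow shape p)ᶜ := hPA ▸ mem_iUnion.2 ⟨i, hi⟩
    exact this hx
  have hmemP : ∀ x ∉ shadow shape p, ∃ i, x ∈ P i := fun x hx => by
    have : x ∈ ⋃ i, P i := by rw [hPA]; exact hx
    exact mem_iUnion.1 this
  have hγB : ∀ x ∉ shadow shape p, γ x • x ∈ shadow B p := fun x hx => by
    obtain ⟨i, hi⟩ := hmemP x hx
    rw [hγv i x hi]
    exact hPB i (smul_mem_smul_set hi)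
  have hγinj : ∀ (x : X) (g h : G), g • x ∉ shadow shape p → h • x ∉ shadow shape p →
      γ (g • x) * g = γ (h • x) * h → g = h := by
    intro x g h hg hh hgh
    obtain ⟨i, hi⟩ := hmemP _ hg
    obtain ⟨j, hj⟩ := hmemP _ hh
    rw [hγv i _ hi, hγv j _ hj] at hgh
    have hij : i = j := by
      by_contra hne
      refine Set.disjoint_left.1 (hPB' hne) (smul_mem_smul_set hi) ?_
      rw [← mul_smul, hgh, mul_smul]
      exact smul_mem_smul_set hj
    subst hij
    exact mul_left_cancel hgh
  have hBsub : shadow B p ⊆ shadow shape p := fun x ⟨i, s, hs, hx⟩ => ⟨i, s, hB i hs, hx⟩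
  let N : X → G := fun x => M (γ x • x) * γ x
  have hN : IsLocallyConstant N := (isLocallyConstant_smul_comp hM hγ).mul hγ
  have hroot : ∀ x g, N (g • x) * g = M ((γ (g • x) * g) • x) * (γ (g • x) * g) := by
    intro x g
    simp only [N]
    rw [mul_smul, mul_assoc]
  -- the elements named `1` are sent by `γ` into a tile centered at `1`
  have hmem : ∀ x g, N (g • x) * g = 1 → ∃ i, p x = some i ∧ γ (g • x) * g ∈ shape i := by
    intro x g hg
    rw [hroot] at hg
    have hcov : (γ (g • x) * g) • x ∈ shadow shape p := by
      by_cases hgx : g • x ∈ shadow shape p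
      · rwa [hγcov _ hgx, one_mul]
      · rw [mul_smul]; exact hBsub (hγB _ hgx)
    obtain ⟨i, s, hs, hps⟩ := hcov
    rw [hMs _ i s hs hps, inv_mul_eq_one] at hg
    rw [← hg, inv_smul_smul] at hps
    exact ⟨i, hps, hg ▸ hs⟩
  refine ⟨N, hN, fun x hx => ?_⟩
  obtain ⟨g, hg⟩ := hx
  obtain ⟨i, hpi, -⟩ := hmem x g ((mem_cell hN).1 hg)
  refine ⟨i, fun s hs => ?_, ?_⟩
  · have hps : p (s⁻¹ • s • x) = some i := by rwa [inv_smul_smul]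
    have h1 : γ (s • x) = 1 := hγcov _ ⟨i, s, hs, hps⟩
    rw [mem_cell hN, hroot, h1, one_mul, hMs _ i s hs hps, inv_mul_cancel]
  · have hunc : ∀ a ∈ cell N x \ shape i, a • x ∉ shadow shape p := by
      intro a ha hcov
      obtain ⟨ha1, ha2⟩ := Finset.mem_sdiff.1 ha
      obtain ⟨j, hpj, hj⟩ := hmem x a ((mem_cell hN).1 ha1)
      rw [hγcov _ hcov, one_mul] at hj
      rw [hpi] at hpj
      obtain rfl := Option.some_injective _ hpj
      exact ha2 hj
    refine Finset.card_le_card_of_injOn (fun a => γ (a • x) * a) (fun a ha => ?_) ?_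
    · obtain ⟨j, hpj, hj⟩ := hmem x a ((mem_cell hN).1 (Finset.mem_sdiff.1 ha).1)
      obtain ⟨l, t, ht, hpt⟩ := hγB _ (hunc a ha)
      rw [← mul_smul (γ (a • x))] at hpt
      have e := hdisj ((γ (a • x) * a) • x) j _ hj l t (hB l ht) (by rwa [inv_smul_smul]) hpt
      rw [← e, inv_smul_smul, hpi] at hpt
      obtain rfl := Option.some_injective _ hpt
      change γ (a • x) * a ∈ B i
      rwa [e]
    · intro a ha b hb hab
      exact hγinj x a b (hunc a ha) (hunc b hb) hab

variable [TopologicalSpace X] [MeasurableSpace X] [BorelSpace X]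
  [ContinuousConstSMul G X]

/-- If the parts `B i` occupy a proportion at least `β` of the tiles and the uncovered elements have
density less than `β / 4`, comparison distributes the latter among the former. -/
lemma AdmitsComparison.isSubequivalent_shadow [Countable G] (hcomp : AdmitsComparison G X)
    {p : X → Option (Fin n)} (hp : IsLocallyConstant p)
    {shape : Fin n → Finset G} (hdisj : HasDisjointTiles shape p) {B : Fin n → Finset G}
    (hB : ∀ i, B i ⊆ shape i) {β : ℝ} (hβ0 : 0 < β) (hβ1 : β ≤ 1)
    (hBβ : ∀ i, β * (shape i).card ≤ (B i).card)
    (hdens : ∀ x : X, 1 - β / 4 < lowerBanachDensity {g : G | g • x ∈ shadow shape p}) :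
    IsSubequivalent G (shadow shape p)ᶜ (shadow B p) := by
  refine hcomp _ _ (isClopen_shadow hp shape).compl (isClopen_shadow hp B) fun μ _ _ => ?_
  have hm : MeasurableSet (shadow shape p) := (isClopen_shadow hp shape).isOpen.measurableSet
  have h1 : ENNReal.ofReal (1 - β / 4) ≤ μ (shadow shape p) :=
    ofReal_le_measure_of_lt_lowerBanachDensity hm μ (by linarith) hdens
  have h2 : ENNReal.ofReal β * μ (shadow shape p) ≤ μ (shadow B p) := by
    rw [measure_shadow μ hp hdisj fun i => subset_rfl, measure_shadow μ hp hdisj hB,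
      Finset.mul_sum]
    refine Finset.sum_le_sum fun i _ => ?_
    rw [← mul_assoc]
    gcongr
    have := ENNReal.ofReal_le_ofReal (hBβ i)
    rwa [ENNReal.ofReal_mul hβ0.le, ENNReal.ofReal_natCast, ENNReal.ofReal_natCast] at this
  calc μ (shadow shape p)ᶜ = 1 - μ (shadow shape p) := prob_compl_eq_one_sub hm
    _ ≤ 1 - ENNReal.ofReal (1 - β / 4) := by gcongr
    _ = ENNReal.ofReal (β / 4) := by
      rw [← ENNReal.ofReal_one, ← ENNReal.ofReal_sub _ (by linarith)]
      congr 1; ring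
    _ < ENNReal.ofReal (β * (1 - β / 4)) := by
      rw [ENNReal.ofReal_lt_ofReal_iff (by nlinarith)]
      nlinarith
    _ = ENNReal.ofReal β * ENNReal.ofReal (1 - β / 4) := ENNReal.ofReal_mul hβ0.le
    _ ≤ ENNReal.ofReal β * μ (shadow shape p) := by gcongr
    _ ≤ μ (shadow B p) := h2

/-- A factor which is a Følner system of disjoint quasitilings yields, under comparison, locally
constant partitions of `G` into arbitrarily invariant finite sets. -/
lemma exists_almostInvariant_cells [CompactSpace X] [Countable G] [Infinite G]
    (hcomp : AdmitsComparison G X)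
    {T : QuasitilingJoining G} (hT : T.IsFolnerSystemOfDisjointQuasitilings)
    (hTX : IsFactorOf G X T.carrier) (K : Finset G) {δ : ℝ} (hδ : 0 < δ) :
    ∃ N : X → G, IsLocallyConstant N ∧
      ∀ x, (cell N x).Nonempty → AlmostInvariant K δ (cell N x) := by
  obtain ⟨⟨⟨ε, -, hε0, hε⟩, hinv⟩, hTd⟩ := hT
  obtain ⟨π, hπ, hπe, hπr⟩ := hTX
  -- `η` bounds the relative size of the change of a tile, half of which is needed for rounding
  let η : ℝ := min (1 / 2) (δ / (4 * (1 + K.card)))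
  have hη : 0 < η := by positivity
  have hη1 : η ≤ 1 / 2 := min_le_left _ _
  have hη2 : (1 + K.card) * η ≤ δ / 4 := by
    have : η ≤ δ / (4 * (1 + K.card)) := min_le_right _ _
    calc (1 + K.card) * η ≤ (1 + K.card) * (δ / (4 * (1 + K.card))) := by gcongr
      _ = δ / 4 := by field_simp
  obtain ⟨β, hβ⟩ : ∃ β, β = η / 2 := ⟨_, rfl⟩
  have hβ0 : 0 < β := by linarith
  let δ' : ℝ := min 1 (δ / 4)
  have hδ' : 0 < δ' := by positivity
  -- a large set `K₁` forces the shapes to be so large that the rounding error is harmless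
  obtain ⟨m, hm⟩ := exists_nat_gt (2 / β)
  obtain ⟨K₁, hKK₁, hK₁⟩ := Infinite.exists_superset_card_eq K (K.card + m + 1) (by omega)
  have hK₁ne : K₁.Nonempty := Finset.card_pos.1 (by omega)
  obtain ⟨k, hk1, hk2⟩ := ((hinv K₁ hK₁ne δ' hδ').and
    (hε0.eventually (gt_mem_nhds (by positivity : (0 : ℝ) < β / 4)))).exists
  let shape := (T.level k).shape
  let p : X → Option (Fin (T.level k).numShapes) := fun x => π x k 1
  have hp : IsLocallyConstant p :=
    Config.isLocallyConstant_apply (f := fun x => π x k) ((continuous_apply k).comp hπ) 1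
  have hpx : ∀ x g, π x k g = p (g • x) := by
    intro x g
    change π x k g = π (g • x) k 1
    rw [hπe]
    change π x k g = π x k (1 * g)
    rw [one_mul]
  have hmemk : ∀ x, π x k ∈ (T.level k).carrier := fun x => by
    rw [← T.image_eval k, ← hπr]
    exact ⟨_, ⟨x, rfl⟩, rfl⟩
  have htile : ∀ x c i, p (c • x) = some i → tile shape (π x k) c = rightTranslate (shape i) c := by
    intro x c i h
    rw [tile, hpx, h]; rfl
  have hdisj : HasDisjointTiles shape p := by
    intro x i s hs j t ht hi hj
    by_contra hne
    have h1 := hTd k _ (hmemk x)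
    have h2 : s⁻¹ ∈ centers (π x k) := by simp [centers, hpx, hi]
    have h3 : t⁻¹ ∈ centers (π x k) := by simp [centers, hpx, hj]
    have h4 := h1 h2 h3 (fun e => hne (inv_injective e))
    change Disjoint (tile shape (π x k) s⁻¹) (tile shape (π x k) t⁻¹) at h4
    rw [htile x _ i hi, htile x _ j hj] at h4
    have h5 : (1 : G) ∈ rightTranslate (shape i) s⁻¹ := by simpa [mem_rightTranslate] using hs
    have h6 : (1 : G) ∈ rightTranslate (shape j) t⁻¹ := by simpa [mem_rightTranslate] using ht
    exact Finset.disjoint_left.1 h4 h5 h6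
  have hcov : ∀ x, covered shape (π x k) = {g : G | g • x ∈ shadow shape p} := by
    intro x
    ext g
    simp only [covered, mem_iUnion, exists_prop]
    constructor
    · rintro ⟨c, hc, hg⟩
      obtain ⟨i, hi⟩ := Option.ne_none_iff_exists'.1 hc
      rw [hpx] at hi
      rw [htile x c i hi, Finset.mem_coe, mem_rightTranslate] at hg
      exact ⟨i, _, hg, by simpa [smul_smul] using hi⟩
    · rintro ⟨i, s, hs, hi⟩
      rw [smul_smul] at hi
      refine ⟨s⁻¹ * g, by simp [centers, hpx, hi], ?_⟩
      rw [htile x _ i hi, Finset.mem_coe, mem_rightTranslate]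
      simpa using hs
  have hdens : ∀ x : X, 1 - β / 4 < lowerBanachDensity {g : G | g • x ∈ shadow shape p} := by
    intro x
    have := ((hε k).2.2 _ (hmemk x)).2
    unfold IsCoveringQT at this
    rw [← hcov x]
    exact lt_of_lt_of_le (by linarith) this
  have hcard : ∀ i, 1 ≤ β * (shape i).card := by
    intro i
    have h1 : AlmostInvariant K₁ 1 (shape i) :=
      (hk1 i).almostInvariant.mono subset_rfl (min_le_left _ _)
    have h2 := h1.card_le ⟨1, (T.level k).one_mem_shape i⟩
    have h3 : (m : ℝ) ≤ 2 * (shape i).card := by exact_mod_cast (by omega)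
    have h4 : 2 / β < 2 * (shape i).card := hm.trans_le h3
    rw [div_lt_iff₀ (by positivity)] at h4
    linarith
  have hB : ∀ i, ∃ B ⊆ shape i, B.card = ⌈β * (shape i).card⌉₊ := by
    intro i
    refine Finset.exists_subset_card_eq (Nat.ceil_le.2 ?_)
    have : β ≤ 1 := by linarith
    exact mul_le_of_le_one_left (Nat.cast_nonneg _) this
  choose B hB hBc using hB
  have hsub := hcomp.isSubequivalent_shadow hp hdisj hB (β := β) (by positivity) (by linarith)
    (fun i => by rw [hBc]; exact Nat.le_ceil _) hdens
  obtain ⟨N, hN, hNc⟩ := exists_name_of_isSubequivalent hp hdisj hB hsub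
  refine ⟨N, hN, fun x hx => ?_⟩
  obtain ⟨i, hi1, hi2⟩ := hNc x hx
  have h1 : AlmostInvariant K δ' (shape i) := (hk1 i).almostInvariant.mono hKK₁ le_rfl
  have h2 : ((cell N x \ shape i).card : ℝ) ≤ η * (shape i).card := by
    have e1 : ((cell N x \ shape i).card : ℝ) ≤ (B i).card := by exact_mod_cast hi2
    have e2 : ((B i).card : ℝ) < β * (shape i).card + 1 := by
      rw [hBc]; exact Nat.ceil_lt_add_one (mul_nonneg hβ0.le (Nat.cast_nonneg _))
    have e3 := hcard i
    have e4 : η * (shape i).card = β * (shape i).card + β * (shape i).card := by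
      rw [hβ]; ring
    linarith
  have h3 : ((shape i \ cell N x).card : ℝ) ≤ η * (shape i).card := by
    rw [Finset.sdiff_eq_empty_iff_subset.2 hi1, Finset.card_empty, Nat.cast_zero]
    exact mul_nonneg hη.le (Nat.cast_nonneg _)
  refine (h1.modify h3 h2 hη1 hη.le hδ'.le).mono subset_rfl ?_
  have : δ' ≤ δ / 4 := min_le_right _ _
  linarith

end Completion

/-! ### Congruent towers of tilings -/

/-- A sequence of locally constant tilings of `G` attached to the points of `X`. The tile of the
`k`th tiling containing `g` has the center `r k (g • x) * g`, which belongs to the tile by `center`;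
every tile is contained in a tile of the next tiling. -/
structure TilingTower (G X : Type*) [Group G] [TopologicalSpace X] [MulAction G X] where
  r : ℕ → X → G
  isLocallyConstant : ∀ k, IsLocallyConstant (r k)
  center : ∀ k x, r k (r k x • x) = 1
  congruent : ∀ k x g h, r k (g • x) * g = r k (h • x) * h →
    r (k + 1) (g • x) * g = r (k + 1) (h • x) * h

section Existence

variable {G : Type*} [Group G] {X : Type*} [TopologicalSpace X] [MulAction G X]
  [CompactSpace X] [ContinuousConstSMul G X]

lemma exists_tilingTower [Countable G]
    (hinv : ∀ (K : Finset G) (δ : ℝ), 0 < δ → ∃ N : X → G, IsLocallyConstant N ∧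
      ∀ x, (cell N x).Nonempty → AlmostInvariant K δ (cell N x)) :
    ∃ R : TilingTower G X, ∀ (K : Finset G) (δ : ℝ), 0 < δ →
      ∀ᶠ k in atTop, ∀ x, (cell (R.r k) x).Nonempty → AlmostInvariant K δ (cell (R.r k) x) := by
  obtain ⟨e, he⟩ := exists_surjective_nat G
  let K : ℕ → Finset G := fun k => (Finset.range k).image e
  let δ : ℕ → ℝ := fun k => 1 / ((k : ℝ) + 1)
  have hδ : ∀ k, 0 < δ k := fun k => Nat.one_div_pos_of_nat
  let P : ℕ → (X → G) → Prop := fun k r => IsLocallyConstant r ∧ (∀ x, r (r x • x) = 1) ∧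
    ∀ x, (cell r x).Nonempty → AlmostInvariant (K k) (δ k) (cell r x)
  have hrec : ∀ k (N : X → G), IsLocallyConstant N →
      (∀ x, (cell N x).Nonempty → AlmostInvariant (K k) (δ k) (cell N x)) →
      ∃ r, P k r ∧
        ∀ x g h, N (g • x) * g = N (h • x) * h → r (g • x) * g = r (h • x) * h := by
    intro k N hN hNinv
    obtain ⟨r, hr1, hr2, hr3, hr4⟩ := exists_recentering hN
    refine ⟨r, ⟨hr1, hr2, fun x hx => ?_⟩, hr3⟩
    obtain ⟨u, hu, hux⟩ := hr4 x hx
    rw [hux]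
    exact (hNinv _ hu).rightTranslate u
  have hzero : ∃ r, P 0 r := by
    obtain ⟨N, hN, hNinv⟩ := hinv (K 0) (δ 0) (hδ 0)
    obtain ⟨r, hr, -⟩ := hrec 0 N hN hNinv
    exact ⟨r, hr⟩
  have hsucc : ∀ k r, P k r → ∃ r', P (k + 1) r' ∧
      ∀ x g h, r (g • x) * g = r (h • x) * h → r' (g • x) * g = r' (h • x) * h := by
    intro k r hr
    obtain ⟨N, hN, hNinv, hNr⟩ := exists_merging hr.1 (K (k + 1)) (hδ (k + 1)) hinv
    obtain ⟨r', hr', hr'N⟩ := hrec (k + 1) N hN hNinv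
    exact ⟨r', hr', fun x g h hgh => hr'N x g h (hNr x g h hgh)⟩
  choose! next hnext using hsucc
  obtain ⟨r₀, hr₀⟩ := hzero
  let r : ℕ → X → G := fun k => Nat.rec r₀ next k
  have hr : ∀ k, P k (r k) := fun k => by
    induction k with
    | zero => exact hr₀
    | succ k ih => exact (hnext k _ ih).1
  refine ⟨⟨r, fun k => (hr k).1, fun k => (hr k).2.1, fun k => (hnext k _ (hr k)).2⟩, ?_⟩
  intro K' δ' hδ'
  have h1 : ∀ᶠ k in atTop, δ k < δ' :=
    tendsto_one_div_add_atTop_nhds_zero_nat.eventually (gt_mem_nhds hδ')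
  have h2 : ∀ᶠ k in atTop, K' ⊆ K k := by
    have : ∀ᶠ k in atTop, ∀ g ∈ K', g ∈ K k := by
      refine (Finset.eventually_all K').2 fun g _ => ?_
      obtain ⟨m, rfl⟩ := he g
      filter_upwards [eventually_gt_atTop m] with k hk
      exact Finset.mem_image_of_mem _ (Finset.mem_range.2 hk)
    exact this
  filter_upwards [h1, h2] with k hk1 hk2 x hx
  exact ((hr k).2.2 x hx).mono hk2 hk1.le

end Existence

/-! ### Labels which record the hierarchy of subtiles -/

/-- An injective code for pairs consisting of a shape and a finite set of labelled positions. -/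
def patternCode (G : Type*) [Countable G] : Finset G × Finset (ℕ × G) → ℕ :=
  (exists_injective_nat _).choose

lemma patternCode_injective {G : Type*} [Countable G] : Function.Injective (patternCode G) :=
  (exists_injective_nat _).choose_spec

namespace TilingTower

variable {G : Type*} [Group G] {X : Type*} [TopologicalSpace X] [MulAction G X]
  (R : TilingTower G X)

lemma r_center (k : ℕ) (x : X) (g : G) : R.r k ((R.r k (g • x) * g) • x) = 1 := by
  rw [mul_smul]; exact R.center k _

/-- An element of `G` and the center of its tile lie in the same tile of the next tiling. -/
lemma root_center (k : ℕ) (x : X) (g : G) :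
    R.r (k + 1) ((R.r k (g • x) * g) • x) * (R.r k (g • x) * g) = R.r (k + 1) (g • x) * g := by
  refine R.congruent k x _ _ ?_
  rw [R.r_center, one_mul]

section Labels

variable [Countable G]

/-- The label of the tile of the `k`th tiling centered at `1` (only relevant for points `x` such
that `1` is a center): it encodes the shape of the tile and, recursively, the positions and the
labels of the tiles of the previous tiling contained in it. -/
def label : ℕ → X → ℕ
  | 0, x => patternCode G (cell (R.r 0) x, ∅)
  | k + 1, x => patternCode G (cell (R.r (k + 1)) x,
      ((cell (R.r (k + 1)) x).filter fun g => R.r k (g • x) = 1).image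
        fun g => (label k (g • x), g))

variable {R}

lemma cell_eq_of_label_eq {k : ℕ} {x y : X} (h : R.label k x = R.label k y) :
    cell (R.r k) x = cell (R.r k) y := by
  cases k with
  | zero => exact (Prod.ext_iff.1 (patternCode_injective h)).1
  | succ k => exact (Prod.ext_iff.1 (patternCode_injective h)).1

lemma label_subtile {k : ℕ} {x y : X} (h : R.label (k + 1) x = R.label (k + 1) y) {g : G}
    (hg : g ∈ cell (R.r (k + 1)) x) (hgx : R.r k (g • x) = 1) :
    R.r k (g • y) = 1 ∧ R.label k (g • y) = R.label k (g • x) := by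
  have h1 := (Prod.ext_iff.1 (patternCode_injective h)).2
  have h2 : (R.label k (g • x), g) ∈ ((cell (R.r (k + 1)) x).filter
      fun g => R.r k (g • x) = 1).image fun g => (R.label k (g • x), g) :=
    Finset.mem_image_of_mem (fun g => (R.label k (g • x), g)) (Finset.mem_filter.2 ⟨hg, hgx⟩)
  change _ = ((cell (R.r (k + 1)) y).filter fun g => R.r k (g • y) = 1).image
    fun g => (R.label k (g • y), g) at h1
  change ((cell (R.r (k + 1)) x).filter fun g => R.r k (g • x) = 1).image
    (fun g => (R.label k (g • x), g)) = _ at h1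
  rw [h1] at h2
  obtain ⟨a, ha, hag⟩ := Finset.mem_image.1 h2
  obtain ⟨h3, rfl⟩ := Prod.mk_inj.1 hag
  exact ⟨(Finset.mem_filter.1 ha).2, h3⟩

variable (R) [CompactSpace X] [ContinuousConstSMul G X]

lemma isLocallyConstant_label (k : ℕ) : IsLocallyConstant (R.label k) := by
  induction k with
  | zero =>
    rw [IsLocallyConstant.iff_eventually_eq]
    intro x
    filter_upwards [eventually_cell_eq (R.isLocallyConstant 0) x] with y hy
    simp only [label, hy]
  | succ k ih =>
    rw [IsLocallyConstant.iff_eventually_eq]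
    intro x
    have h1 : ∀ᶠ y in 𝓝 x, ∀ g ∈ cell (R.r (k + 1)) x, R.r k (g • y) = R.r k (g • x) :=
      (Finset.eventually_all _).2 fun g _ => eventually_smul_eq (R.isLocallyConstant k) g x
    have h2 : ∀ᶠ y in 𝓝 x, ∀ g ∈ cell (R.r (k + 1)) x, R.label k (g • y) = R.label k (g • x) :=
      (Finset.eventually_all _).2 fun g _ => eventually_smul_eq ih g x
    filter_upwards [eventually_cell_eq (R.isLocallyConstant (k + 1)) x, h1, h2] with y hy h1 h2
    simp only [label, hy]
    congr 2
    rw [Finset.filter_congr fun g hg => by rw [h1 g hg]]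
    refine Finset.image_congr fun g hg => ?_
    simp only [h2 g (Finset.mem_filter.1 hg).1]

/-! ### The tiling system -/

/-- The labels which occur at centers. -/
abbrev Labels (k : ℕ) : Type := {m : ℕ // ∃ x, R.r k x = 1 ∧ R.label k x = m}

instance (k : ℕ) : Finite (R.Labels k) :=
  ((R.isLocallyConstant_label k).range_finite.subset (by
    rintro _ ⟨x, -, rfl⟩; exact mem_range_self x) :
    {m : ℕ | ∃ x, R.r k x = 1 ∧ R.label k x = m}.Finite).to_subtype

/-- The enumeration of the labels. -/
def labelEquiv (k : ℕ) : R.Labels k ≃ Fin (Nat.card (R.Labels k)) := Finite.equivFin _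

/-- A point for which `1` is a center with the given label. -/
def rep (k : ℕ) (i : Fin (Nat.card (R.Labels k))) : X := ((R.labelEquiv k).symm i).2.choose

lemma r_rep (k : ℕ) (i) : R.r k (R.rep k i) = 1 := ((R.labelEquiv k).symm i).2.choose_spec.1

lemma label_rep (k : ℕ) (i) : R.label k (R.rep k i) = ((R.labelEquiv k).symm i).1 :=
  ((R.labelEquiv k).symm i).2.choose_spec.2

/-- The symbol at `1` of the `k`th tiling of a point. -/
def symbol (k : ℕ) (x : X) : Option (Fin (Nat.card (R.Labels k))) :=
  if h : R.r k x = 1 then some (R.labelEquiv k ⟨R.label k x, x, h, rfl⟩) else none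

lemma symbol_eq_some {k : ℕ} {x : X} {i} :
    R.symbol k x = some i ↔ R.r k x = 1 ∧ R.label k x = R.label k (R.rep k i) := by
  rw [label_rep, symbol]
  split_ifs with h
  · rw [Option.some_inj, ← Equiv.eq_symm_apply, Subtype.ext_iff]
    simp [h]
  · simp [h]

lemma exists_symbol_eq_some {k : ℕ} {x : X} (h : R.r k x = 1) : ∃ i, R.symbol k x = some i :=
  ⟨_, dif_pos h⟩

lemma isLocallyConstant_symbol (k : ℕ) : IsLocallyConstant (R.symbol k) := by
  rw [IsLocallyConstant.iff_eventually_eq]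
  intro x
  filter_upwards [(R.isLocallyConstant k).eventually_eq x,
    (R.isLocallyConstant_label k).eventually_eq x] with y h1 h2
  simp only [symbol, h1, h2]

/-- The configuration of the `k`th tiling of a point. -/
def config (k : ℕ) (x : X) : Config G (Nat.card (R.Labels k)) := fun g => R.symbol k (g • x)

lemma continuous_config (k : ℕ) : Continuous (R.config k) :=
  Config.continuous_of_isLocallyConstant fun g =>
    (R.isLocallyConstant_symbol k).comp_continuous (continuous_const_smul g)

lemma config_smul (k : ℕ) (g : G) (x : X) : R.config k (g • x) = g • R.config k x := by
  funext f
  change R.symbol k (f • g • x) = R.symbol k ((f * g) • x)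
  rw [mul_smul]

/-- The shape belonging to a label. -/
def shape (k : ℕ) (i : Fin (Nat.card (R.Labels k))) : Finset G := cell (R.r k) (R.rep k i)

lemma one_mem_shape (k : ℕ) (i) : 1 ∈ R.shape k i := by
  rw [shape, mem_cell (R.isLocallyConstant k), one_smul, R.r_rep, one_mul]

lemma mem_rightTranslate_shape {k : ℕ} {x : X} {c : G} {i} (h : R.symbol k (c • x) = some i)
    {g : G} : g ∈ rightTranslate (R.shape k i) c ↔ R.r k (g • x) * g = c := by
  rw [mem_rightTranslate, shape, ← cell_eq_of_label_eq (R.symbol_eq_some.1 h).2,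
    mem_cell (R.isLocallyConstant k), smul_smul, inv_mul_cancel_right, ← mul_assoc, mul_inv_eq_one]

lemma mem_centers {k : ℕ} {x : X} {c : G} :
    c ∈ centers (R.config k x) ↔ R.r k (c • x) = 1 := by
  simp [centers, config, symbol]

lemma mem_tile {k : ℕ} {x : X} {c g : G} :
    g ∈ tile (R.shape k) (R.config k x) c ↔ R.r k (g • x) * g = c := by
  by_cases hc : R.r k (c • x) = 1
  · obtain ⟨i, hi⟩ := R.exists_symbol_eq_some hc
    rw [← R.mem_rightTranslate_shape hi, tile, config, hi]
    rfl
  · have h1 : R.config k x c = none := by simp [config, symbol, hc]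
    rw [tile, h1]
    simp only [Option.elim_none, Finset.notMem_empty, false_iff]
    rintro rfl
    exact hc (R.r_center k x g)

lemma isTiling_config (k : ℕ) (x : X) : IsTiling (R.shape k) (R.config k x) := by
  refine ⟨fun c _ c' _ hne => Finset.disjoint_left.2 fun g hg hg' => ?_, ?_⟩
  · exact hne ((R.mem_tile.1 hg).symm.trans (R.mem_tile.1 hg'))
  · refine eq_univ_of_forall fun g => mem_iUnion₂.2 ⟨R.r k (g • x) * g, ?_, ?_⟩
    · exact R.mem_centers.2 (R.r_center k x g)
    · exact R.mem_tile.2 rfl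

end Labels

end TilingTower

lemma isSubsystem_range {G : Type*} [Group G] {X Y : Type*} [TopologicalSpace X]
    [CompactSpace X] [Nonempty X] [TopologicalSpace Y] [T2Space Y] [MulAction G X] [MulAction G Y]
    {f : X → Y} (hf : Continuous f) (hfe : ∀ (g : G) x, f (g • x) = g • f x) :
    IsSubsystem G (range f) where
  nonempty := range_nonempty f
  isClosed := (isCompact_range hf).isClosed
  smul_mem := by
    rintro g _ ⟨x, rfl⟩
    exact ⟨g • x, hfe g x⟩

lemma one_le_lowerBanachDensity_univ {G : Type*} [Group G] :
    1 ≤ lowerBanachDensity (univ : Set G) := by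
  have h1 : lowerDensityOn {1} (univ : Set G) = 1 := by
    simp [lowerDensityOn, rightTranslate]
  rw [← h1]
  refine le_ciSup (f := fun F => lowerDensityOn F (univ : Set G)) ⟨1, ?_⟩ {1}
  rintro _ ⟨F, rfl⟩
  refine (ciInf_le ⟨0, by rintro _ ⟨g, rfl⟩; positivity⟩ 1).trans ?_
  refine div_le_one_of_le₀ ?_ (by positivity)
  rw [univ_inter, ncard_coe_finset]
  simp [rightTranslate]

lemma IsTiling.isEpsDisjointQT {G : Type*} [Group G] {n : ℕ} {shape : Fin n → Finset G}
    (hshape : ∀ i, 1 ∈ shape i) {x : Config G n} (hx : IsTiling shape x) {ε : ℝ} (hε : 0 < ε) :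
    IsEpsDisjointQT ε shape x := by
  refine ⟨tile shape x, fun c hc => ⟨subset_rfl, ?_⟩, hx.1⟩
  obtain ⟨i, hi⟩ := Option.ne_none_iff_exists'.1 hc
  have : 0 < (tile shape x c).card := Finset.card_pos.2
    ⟨c, by rw [tile, hi]; simpa [mem_rightTranslate] using hshape i⟩
  unfold IsModification
  rw [symmDiff_self, Finset.bot_eq_empty, Finset.card_empty, Nat.cast_zero]
  positivity

lemma IsTiling.isCoveringQT {G : Type*} [Group G] {n : ℕ} {shape : Fin n → Finset G}
    {x : Config G n} (hx : IsTiling shape x) {α : ℝ} (hα : α ≤ 1) : IsCoveringQT α shape x := by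
  unfold IsCoveringQT
  rw [hx.2]
  exact hα.trans one_le_lowerBanachDensity_univ

namespace TilingTower

variable {G : Type*} [Group G] [Countable G] {X : Type*} [TopologicalSpace X] [MulAction G X]
  [CompactSpace X] [ContinuousConstSMul G X] [Nonempty X] (R : TilingTower G X)

/-- The joining of the tilings of a tower, as an image of `X`. -/
def joining : QuasitilingJoining G where
  level k :=
    { numShapes := Nat.card (R.Labels k)
      shape := R.shape k
      one_mem_shape := R.one_mem_shape k
      carrier := range (R.config k)
      isSubsystem := isSubsystem_range (R.continuous_config k) (R.config_smul k) }
  carrier := range fun x k => R.config k x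
  isSubsystem := isSubsystem_range (continuous_pi R.continuous_config)
    fun g x => funext fun k => R.config_smul k g x
  image_eval k := by
    rw [← range_comp]; rfl

lemma isFactorOf_joining : IsFactorOf G X R.joining.carrier :=
  ⟨fun x k => R.config k x, continuous_pi R.continuous_config,
    fun g x => funext fun k => R.config_smul k g x, rfl⟩

lemma isCongruent_joining : R.joining.IsCongruent := by
  rintro _ ⟨x, rfl⟩ k c' -
  refine ⟨{c | R.r k (c • x) = 1 ∧ R.r (k + 1) (c • x) * c = c'},
    fun c hc => R.mem_centers.2 hc.1, ?_⟩
  change (tile (R.shape (k + 1)) (R.config (k + 1) x) c' : Set G) =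
    ⋃ c ∈ {c | R.r k (c • x) = 1 ∧ R.r (k + 1) (c • x) * c = c'},
      (tile (R.shape k) (R.config k x) c : Set G)
  ext g
  simp only [mem_iUnion₂, Finset.mem_coe, mem_tile]
  constructor
  · intro hg
    exact ⟨_, ⟨R.r_center k x g, (R.root_center k x g).trans hg⟩, rfl⟩
  · rintro ⟨c, ⟨-, hc⟩, rfl⟩
    exact (R.root_center k x g).symm.trans hc

lemma isDeterministic_joining : R.joining.IsDeterministic := by
  intro k j
  change Fin (Nat.card (R.Labels (k + 1))) at j
  set y := R.rep (k + 1) j with hy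
  have hmem : ∀ g, g ∈ R.shape (k + 1) j ↔ R.r (k + 1) (g • y) * g = 1 := fun g =>
    mem_cell (R.isLocallyConstant (k + 1))
  let C : Fin (Nat.card (R.Labels k)) → Finset G := fun i =>
    (R.shape (k + 1) j).filter fun g => R.symbol k (g • y) = some i
  refine ⟨C, fun i => Finset.filter_subset _ _, ?_, ?_, ?_⟩
  · change (R.shape (k + 1) j : Set G) = ⋃ i, ⋃ c ∈ C i, (rightTranslate (R.shape k i) c : Set G)
    ext g
    simp only [mem_iUnion, Finset.mem_coe, exists_prop, C, Finset.mem_filter, hmem]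
    constructor
    · intro hg
      obtain ⟨i, hi⟩ := R.exists_symbol_eq_some (R.r_center k y g)
      exact ⟨i, _, ⟨(R.root_center k y g).trans hg, hi⟩, (R.mem_rightTranslate_shape hi).2 rfl⟩
    · rintro ⟨i, c, ⟨hc, hi⟩, hg⟩
      obtain rfl := (R.mem_rightTranslate_shape hi).1 hg
      exact (R.root_center k y g).symm.trans hc
  · rintro ⟨i, c⟩ hc ⟨i', c'⟩ hc' hne
    refine Finset.disjoint_left.2 fun g hg hg' => hne ?_
    have hi := (Finset.mem_filter.1 hc).2
    have hi' := (Finset.mem_filter.1 hc').2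
    obtain rfl := (R.mem_rightTranslate_shape hi).1 hg
    obtain rfl := (R.mem_rightTranslate_shape hi').1 hg'
    rw [hi] at hi'
    exact Prod.ext (Option.some_injective _ hi') rfl
  · rintro _ ⟨x, rfl⟩ c' hc' i c hc
    change R.symbol (k + 1) (c' • x) = some j at hc'
    obtain ⟨hc1, hc2⟩ := Finset.mem_filter.1 hc
    obtain ⟨h1, h2⟩ := R.symbol_eq_some.1 hc2
    obtain ⟨h3, h4⟩ := label_subtile (R.symbol_eq_some.1 hc').2.symm hc1 h1
    change R.symbol k ((c * c') • x) = some i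
    rw [mul_smul]
    exact R.symbol_eq_some.2 ⟨h3, h4.trans h2⟩

lemma isTilingSystem_joining (hR : ∀ (K : Finset G) (δ : ℝ), 0 < δ →
    ∀ᶠ k in atTop, ∀ x, (cell (R.r k) x).Nonempty → AlmostInvariant K δ (cell (R.r k) x)) :
    R.joining.IsTilingSystem := by
  have htil : ∀ k, (R.joining.level k).IsDynamicalTiling := by
    rintro k _ ⟨x, rfl⟩
    exact R.isTiling_config k x
  refine ⟨⟨⟨⟨fun k => 1 / ((k + 1 : ℕ) + 1 : ℝ), ?_, ?_, fun k => ⟨by positivity, ?_, ?_⟩⟩, ?_⟩,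
    htil⟩, R.isCongruent_joining, R.isDeterministic_joining⟩
  · intro a b hab
    dsimp only
    gcongr
  · exact tendsto_one_div_add_atTop_nhds_zero_nat.comp (tendsto_add_atTop_nat 1)
  · rw [div_lt_one (by positivity)]
    push_cast
    linarith [(Nat.cast_nonneg k : (0 : ℝ) ≤ k)]
  · intro x hx
    refine ⟨(htil k x hx).isEpsDisjointQT (R.one_mem_shape k) (by positivity),
      (htil k x hx).isCoveringQT ?_⟩
    rw [sub_le_self_iff]
    positivity
  · intro K hK δ hδ
    filter_upwards [hR K (δ / 3) (by positivity)] with k hk i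
    have hne : (R.shape k i).Nonempty := ⟨1, R.one_mem_shape k i⟩
    exact (hk (R.rep k i) hne).isKInvariant hK hne (by linarith)

end TilingTower

end

end TilingSystems

theorem mainTheorem7 {G : Type*} [Group G] [Countable G] [Infinite G]
    (hG : TilingSystems.IsAmenable G)
    {X : Type*} [MetricSpace X] [CompactSpace X] [MeasurableSpace X] [BorelSpace X]
    (hX : TopologicalSpace.IsTopologicalBasis {U : Set X | IsClopen U})
    [MulAction G X] [ContinuousConstSMul G X]
    (hcomp : TilingSystems.AdmitsComparison G X)
    (hqt : ∃ T : TilingSystems.QuasitilingJoining G,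
      T.IsFolnerSystemOfDisjointQuasitilings ∧ TilingSystems.IsFactorOf G X T.carrier) :
    ∃ T : TilingSystems.QuasitilingJoining G,
      T.IsTilingSystem ∧ TilingSystems.IsFactorOf G X T.carrier := by
  obtain ⟨T, hT, hTX⟩ := hqt
  have hne : Nonempty X := by
    obtain ⟨π, -, -, hπ⟩ := hTX
    exact range_nonempty_iff_nonempty.1 (hπ ▸ T.isSubsystem.nonempty)
  obtain ⟨R, hR⟩ := TilingSystems.exists_tilingTower
    fun K _ hδ => TilingSystems.exists_almostInvariant_cells hcomp hT hTX K hδ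
  exact ⟨R.joining, R.isTilingSystem_joining hR, R.isFactorOf_joining⟩
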